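/- All graphs are finite, simple and undirected. For a graph $G$, let $\rho(G)$ denote the largest eigenvalue of its adjacency matrix. Let $K_m$ and $I_m$ denote the complete graph and the edgeless graph on $m$ vertices, $G_1+G_2$ the disjoint union of $G_1$ and $G_2$, and $G_1\vee G_2$ their join, obtained from $G_1+G_2$ by adding all edges between $V(G_1)$ and $V(G_2)$. A leaf of a tree $T$ is a vertex of degree $1$ in $T$; the leaf degree of a vertex $v$ of $T$ is the number of leaves of $T$ adjacent to $v$ in $T$; and the leaf degree of $T$ is the maximum leaf degree among all its vertices. Theorem. Let $k\ge 1$ be an integer and let $G$ be a connected graph of order $n$ with minimum degree $\delta$, where $n\ge 3(k+2)\delta+2$. If $$\rho(G)\ \ge\ \rho\bigl(K_\delta\vee(K_{n-k\delta-2\delta}+I_{k\delta+\delta})\bigr),$$ then $G$ has a spanning tree with leaf degree at most $k$ unless $G\cong K_\delta\vee(K_{n-k\delta-2\delta}+I_{k\delta+\delta})$; and in this exceptional case $G$ has no spanning tree with leaf degree at most $k$. -/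

import Mathlib

namespace LeafDegreeSpectral

/-- The join of two graphs on disjoint vertex sets: their disjoint union together with all edges
between the two vertex sets. -/
def join {V W : Type*} (G : SimpleGraph V) (H : SimpleGraph W) : SimpleGraph (V ⊕ W) where
  Adj
    | Sum.inl a, Sum.inl b => G.Adj a b
    | Sum.inr a, Sum.inr b => H.Adj a b
    | Sum.inl _, Sum.inr _ => True
    | Sum.inr _, Sum.inl _ => True
  symm := ⟨by
    rintro (a | a) (b | b) h
    · exact G.adj_symm h
    · trivial
    · trivial
    · exact H.adj_symm h⟩
  loopless := ⟨by
    rintro (a | a) h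
    · exact G.loopless.irrefl a h
    · exact H.loopless.irrefl a h⟩

/-- The graph `K_a ∨ (K_b + I_c)`, where `I_c` is the edgeless graph on `c` vertices. -/
def joinCompleteUnion (a b c : ℕ) : SimpleGraph (Fin a ⊕ (Fin b ⊕ Fin c)) :=
  join (⊤ : SimpleGraph (Fin a))
    (SimpleGraph.sum (⊤ : SimpleGraph (Fin b)) (⊥ : SimpleGraph (Fin c)))

open Classical in
/-- The set of (real) eigenvalues of the adjacency matrix of `G`. -/
noncomputable def adjEigenvalues {V : Type*} [Fintype V] (G : SimpleGraph V) : Set ℝ :=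
  {μ : ℝ | Module.End.HasEigenvalue (Matrix.toLin' (G.adjMatrix ℝ)) μ}

/-- The spectral radius of `G`: the largest eigenvalue of its adjacency matrix. -/
noncomputable def spectralRadius {V : Type*} [Fintype V] (G : SimpleGraph V) : ℝ :=
  sSup (adjEigenvalues G)

/-- The supremum in the definition of the spectral radius is attained. -/
theorem spectralRadius_isGreatest {V : Type*} [Fintype V] [Nonempty V] (G : SimpleGraph V) :
    IsGreatest (adjEigenvalues G) (spectralRadius G) := by
  classical
  have hfin : (adjEigenvalues G).Finite := Module.End.finite_hasEigenvalue _
  have hA : (G.adjMatrix ℝ).IsHermitian := G.isHermitian_adjMatrix ℝ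
  have hne : (adjEigenvalues G).Nonempty := by
    refine ⟨hA.eigenvalues (Classical.arbitrary V), ?_⟩
    have h := hA.eigenvalues_mem_spectrum_real (Classical.arbitrary V)
    rw [← Matrix.spectrum_toLin', ← Module.End.hasEigenvalue_iff_mem_spectrum] at h
    unfold adjEigenvalues
    convert h
  exact ⟨hne.csSup_mem hfin, fun μ hμ => le_csSup hfin.bddAbove hμ⟩

/-- A leaf of `T` is a vertex with exactly one neighbour in `T`. -/
def IsLeaf {V : Type*} (T : SimpleGraph V) (v : V) : Prop :=
  (T.neighborSet v).ncard = 1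

/-- The leaf degree of a vertex `v` of `T`: the number of leaves of `T` adjacent to `v` in `T`. -/
noncomputable def vertexLeafDegree {V : Type*} (T : SimpleGraph V) (v : V) : ℕ :=
  {w : V | T.Adj v w ∧ IsLeaf T w}.ncard

/-- The leaf degree of `T`: the maximum leaf degree among all vertices of `T`. -/
noncomputable def leafDegree {V : Type*} [Fintype V] (T : SimpleGraph V) : ℕ :=
  Finset.univ.sup (vertexLeafDegree T)

/-- `T` is a spanning tree of `G`. -/
def IsSpanningTree {V : Type*} (T G : SimpleGraph V) : Prop :=
  T ≤ G ∧ T.IsTree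

end LeafDegreeSpectral

/-!
Put `m = k + 1`. By a theorem of Kaneko, `G` has a spanning tree of leaf degree at most `k` if and
only if deleting any nonempty set `S` of vertices leaves fewer than `m * #S` isolated vertices.

*Necessity.* If `I` is the set of isolated vertices of `G - S`, then at most `k * #S` vertices of
`I` are leaves of the tree. Rooting the tree in `S`, each of the other vertices of `I` has a child,
and these children are distinct nonroot vertices of `S`.

*Sufficiency.* By Hall's theorem each vertex can choose a neighbour so that no vertex is chosen more
than `m` times. Take such a choice with as many mutual choices as possible. The resulting edges form
a forest, in which only critical vertices carry `m` leaves that are pairwise nonadjacent in `G`.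
Since Hall's condition is strict, the critical vertices can be given levels along which some leaf of
each is connected to a vertex of lower level, and the forest stays acyclic. Extend it to a spanning
tree. A vertex still carrying `m` leaves has two that are adjacent in `G`; hanging one on the other
lowers the number of leaves, so a tree minimizing that number has leaf degree at most `k`.

*Spectral part.* If Kaneko's condition fails at `S`, then `G` is a subgraph of
`K_s ∨ (K_(n - (m + 1) s) + I_(m s))` with `s = #S ≥ δ`. Let `r` be a root above `n - m δ - 1` of
the quotient polynomial for `s = δ`; it is an eigenvalue of the extremal graph, so `r ≤ ρ(G)`. The
polynomial for `s > δ` is positive at `r`, so a positive vector `x` that is constant on the parts of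
the larger graph satisfies `A x ≤ r x`. Comparing `x` with an eigenvector of `G` for `ρ(G)` forces
equality everywhere, whence `s = δ` and `G` is extremal.
-/

namespace LeafDegreeSpectral

open Finset

/-- Deleting any nonempty vertex set `S` leaves fewer than `m * #S` isolated vertices; this is
Kaneko's condition, with `m = k + 1`. The set `I` ranges over the sets of isolated vertices. -/
def IsolatedBound {V : Type*} (G : SimpleGraph V) (m : ℕ) : Prop :=
  ∀ S I : Finset V, S.Nonempty → (∀ v ∈ I, v ∉ S ∧ ∀ w, G.Adj v w → w ∈ S) → #I < m * #S

theorem IsolatedBound.card_lt_mul_card_neighbors {V : Type*} [Fintype V] {G : SimpleGraph V}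
    [DecidableRel G.Adj] {m : ℕ} (hG : IsolatedBound G m) (hm : 2 ≤ m)
    (hnbr : ∀ v, ∃ w, G.Adj v w) {X : Finset V} (hX : X.Nonempty) :
    #X < m * #{w | ∃ x ∈ X, G.Adj x w} := by
  classical
  set N : Finset V := {w | ∃ x ∈ X, G.Adj x w} with hN
  have mem_N {x w : V} (hx : x ∈ X) (hxw : G.Adj x w) : w ∈ N := by
    simpa [hN] using ⟨x, hx, hxw⟩
  have hX_card := card_sdiff_add_card_inter X N
  have hN_card := card_sdiff_add_card_inter N X
  rw [inter_comm] at hN_card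
  rcases (X \ N).eq_empty_or_nonempty with hXN | ⟨x, hx⟩
  · have : 0 < #X := hX.card_pos
    rw [hXN, card_empty] at hX_card
    nlinarith
  · have isolated : ∀ v ∈ X \ N, ∀ w, G.Adj v w → w ∈ N \ X := fun v hv w hvw => by
      rw [mem_sdiff] at hv ⊢
      exact ⟨mem_N hv.1 hvw, fun hw => hv.2 (mem_N hw hvw.symm)⟩
    obtain ⟨w, hw⟩ := hnbr x
    have : #(X \ N) < m * #(N \ X) :=
      hG _ _ ⟨w, isolated x hx w hw⟩ fun v hv =>
        ⟨fun h => (mem_sdiff.1 h).2 (mem_sdiff.1 hv).1, isolated v hv⟩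
    nlinarith

/-! ### Choosing neighbours -/

/-- The map `f` sends every vertex to a neighbour, and no vertex is chosen more than `m` times. -/
structure IsAssignment {V : Type*} [Fintype V] [DecidableEq V] (G : SimpleGraph V) (m : ℕ)
    (f : V → V) : Prop where
  adj : ∀ v, G.Adj v (f v)
  card_fiber_le : ∀ c, #{v | f v = c} ≤ m

/-- The vertices lying on a `2`-cycle of `f`. -/
def matched {V : Type*} (f : V → V) : Set V := {v | f (f v) = v}

theorem matched_ssubset_matched_update {V : Type*} [DecidableEq V] {f : V → V} {v : V}
    (hv : v ≠ f v) (h : f (f (f v)) ≠ f v) :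
    matched f ⊂ matched (Function.update f (f v) v) := by
  refine (Set.ssubset_iff_of_subset fun u (hu : f (f u) = u) => ?_).2
    ⟨v, by simp [matched, hv], fun hv' : f (f v) = v => h (by rw [hv'])⟩
  have hu_ne : u ≠ f v := by
    rintro rfl
    exact h hu
  have hfu_ne : f u ≠ f v := fun hfu => by
    rw [hfu] at hu
    exact h (by rw [hu, hfu])
  simpa [matched, hu_ne, hfu_ne] using hu

/-- Modifies `f` by matching `u` with `x` and sending `b` to `v` and `b'` to `v'`. -/
def rematch {V : Type*} [DecidableEq V] (f : V → V) (u x b v b' v' : V) : V → V :=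
  Function.update (Function.update (Function.update (Function.update f b v) b' v') u x) x u

theorem rematch_apply {V : Type*} [DecidableEq V] (f : V → V) (u x b v b' v' t : V) :
    rematch f u x b v b' v' t =
      if t = x then u else if t = u then x else if t = b' then v' else
        if t = b then v else f t := by
  simp only [rematch, Function.update_apply]

section Assignment

variable {V : Type*} [Fintype V] [DecidableEq V] {G : SimpleGraph V} {m : ℕ} {f : V → V}

theorem IsolatedBound.exists_isAssignment (hG : IsolatedBound G m) (hm : 2 ≤ m)
    (hnbr : ∀ v, ∃ w, G.Adj v w) : ∃ f, IsAssignment G m f := by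
  classical
  let slots (v : V) : Finset (V × Fin m) := G.neighborFinset v ×ˢ univ
  have hall (X : Finset V) : #X ≤ #(X.biUnion slots) := by
    have : X.biUnion slots = ({w | ∃ x ∈ X, G.Adj x w} : Finset V) ×ˢ univ := by
      ext ⟨w, i⟩
      simp [slots]
    rw [this, card_product, card_univ, Fintype.card_fin, mul_comm]
    rcases X.eq_empty_or_nonempty with rfl | hX
    · simp
    · exact (hG.card_lt_mul_card_neighbors hm hnbr hX).le
  obtain ⟨g, hg_inj, hg⟩ := (all_card_le_biUnion_card_iff_exists_injective slots).1 hall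
  refine ⟨fun v => (g v).1, fun v => by simpa [slots] using hg v, fun c => ?_⟩
  have : Set.InjOn (fun v => (g v).2) (({v | (g v).1 = c} : Finset V) : Set V) :=
    fun a ha b hb hab => hg_inj (Prod.ext (by simp_all) hab)
  simpa using card_le_card_of_injOn _ (fun _ _ => mem_coe.2 (mem_univ _)) this

theorem IsAssignment.update (hf : IsAssignment G m f) {w v : V} (hwv : G.Adj w v)
    (hv : #{u | f u = v} < m) : IsAssignment G m (Function.update f w v) where
  adj u := by
    rcases eq_or_ne u w with rfl | hu
    · simpa using hwv
    · simpa [hu] using hf.adj u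
  card_fiber_le c := by
    rcases eq_or_ne c v with rfl | hc
    · have : ({u | Function.update f w c u = c} : Finset V) ⊆
          insert w ({u | f u = c} : Finset V) := fun u => by
        by_cases hu : u = w <;> simp [hu]
      exact (card_le_card this).trans ((card_insert_le _ _).trans hv)
    · refine (card_le_card fun u => ?_).trans (hf.card_fiber_le c)
      by_cases hu : u = w <;> simp [hu, hc.symm]

theorem card_fiber_lt_of_forall_eq (hm : 2 ≤ m) {v b : V} (h : ∀ u, f u = v → u = b) :
    #{u | f u = v} < m :=
  (card_le_one.2 fun x hx y hy =>
    (h x (mem_filter.1 hx).2).trans (h y (mem_filter.1 hy).2).symm).trans_lt hm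

theorem mul_card_le_card_preimage {C : Finset V} (h : ∀ c ∈ C, m ≤ #{v | f v = c}) :
    m * #C ≤ #{v | f v ∈ C} :=
  calc m * #C = #C • m := by rw [smul_eq_mul, mul_comm]
    _ ≤ ∑ c ∈ C, #{v | f v = c} := card_nsmul_le_sum _ _ _ h
    _ = #{v | f v ∈ C} := sum_card_fiberwise_eq_card_filter _ _ _

theorem apply_apply_apply_of_maximalFor (hm : 2 ≤ m)
    (hf : MaximalFor (IsAssignment G m) matched f) (v : V) : f (f (f v)) = f v := by
  set P : Finset V := {v | f (f (f v)) ≠ f v} with hP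
  have full : ∀ v ∈ P, m ≤ #{u | f u = v} := fun v hv => by
    by_contra! hlt
    exact hf.not_gt (hf.prop.update (hf.prop.adj v).symm hlt)
      (matched_ssubset_matched_update (hf.prop.adj v).ne (by simpa [hP] using hv))
  have card_le : m * #P ≤ #P :=
    (mul_card_le_card_preimage full).trans <| card_le_card fun u hu => by
      simp only [hP, mem_filter, mem_univ, true_and] at hu ⊢
      exact fun h => hu (by rw [h])
  have : P = ∅ := card_eq_zero.1 (by nlinarith)
  by_contra h
  exact notMem_empty v (this ▸ mem_filter.2 ⟨mem_univ v, h⟩)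

/-- A vertex `b` chosen by exactly `m` vertices which are pairwise nonadjacent in `G` and chosen by
nobody except possibly `b`. Adding edges to the graph of `f` while keeping all leaf degrees below
`m` is obstructed only by such vertices. -/
structure IsCritical (G : SimpleGraph V) (m : ℕ) (f : V → V) (b : V) : Prop where
  card_fiber : #{u | f u = b} = m
  eq_of_apply_eq : ∀ u, f u = b → ∀ t, f t = u → t = b
  not_adj : ∀ u, f u = b → ∀ x, f x = b → ¬ G.Adj u x

/-- A vertex `v` with which `b` can be matched once `u` is matched elsewhere; the present partner
`f b` is retained whenever possible. -/
structure IsPartner (f : V → V) (b u v : V) : Prop where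
  apply_eq : f v = b
  ne : v ≠ u
  eq_apply : f b ≠ u → v = f b

namespace IsCritical

variable {b b' u x : V}

theorem not_isCritical_of_apply_eq (hb : IsCritical G m f b) (hm : 2 ≤ m) (hu : f u = b) :
    ¬ IsCritical G m f u := fun h =>
  (card_fiber_lt_of_forall_eq hm (hb.eq_of_apply_eq u hu)).ne h.card_fiber

theorem apply_apply (hb : IsCritical G m f b) (hm : 2 ≤ m) (hcube : ∀ v, f (f (f v)) = f v) :
    f (f b) = b := by
  obtain ⟨u, hu⟩ : ({u | f u = b} : Finset V).Nonempty :=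
    card_pos.1 (by rw [hb.card_fiber]; lia)
  obtain rfl : f u = b := by simpa using hu
  exact hcube u

theorem exists_isPartner (hb : IsCritical G m f b) (hm : 2 ≤ m)
    (hcube : ∀ v, f (f (f v)) = f v) (u : V) : ∃ v, IsPartner f b u v := by
  by_cases hu : f b = u
  · obtain ⟨v, hv, hvu⟩ := exists_mem_ne (hb.card_fiber ▸ hm : 1 < #{u | f u = b}) u
    exact ⟨v, by simpa using hv, hvu, fun h => absurd hu h⟩
  · exact ⟨f b, hb.apply_apply hm hcube, hu, fun _ => rfl⟩

end IsCritical

theorem IsCritical.isAssignment_rematch {b b' u x v v' : V} (hm : 2 ≤ m)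
    (hb : IsCritical G m f b) (hb' : IsCritical G m f b') (hbb' : b ≠ b') (hu : f u = b)
    (hx : f x = b') (hv : IsPartner f b u v) (hv' : IsPartner f b' x v')
    (hf : IsAssignment G m f) (hux : G.Adj u x) :
    IsAssignment G m (rematch f u x b v b' v') := by
  have hvb := hv.apply_eq
  have hvb' := hv'.apply_eq
  have h1 := hf.update (hvb ▸ (hf.adj v).symm)
    (card_fiber_lt_of_forall_eq hm (hb.eq_of_apply_eq v hvb))
  have h2 := h1.update (w := b') (v := v') (hvb' ▸ (hf.adj v').symm)
    (card_fiber_lt_of_forall_eq hm (b := b') fun t ht => by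
      have := hb'.eq_of_apply_eq v' hvb' t
      grind)
  have h3 := h2.update (w := u) hux (card_fiber_lt_of_forall_eq hm (b := b') fun t ht => by
      have := hb'.eq_of_apply_eq x hx t
      grind [hv.ne, hv'.ne])
  exact h3.update hux.symm (card_fiber_lt_of_forall_eq hm (b := b) fun t ht => by
      have := hb.eq_of_apply_eq u hu t
      grind)

theorem IsCritical.rematch_apply_of_isPartner {b b' u x v v' : V} (hm : 2 ≤ m)
    (hb : IsCritical G m f b) (hb' : IsCritical G m f b') (hbb' : b ≠ b') (hu : f u = b)
    (hx : f x = b') (hv : IsPartner f b u v) (hv' : IsPartner f b' x v') {g : V → V}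
    (hg : g = rematch f u x b v b' v') :
    (g u = x ∧ g x = u) ∧ (g b = v ∧ g v = b) ∧ (g b' = v' ∧ g v' = b') := by
  have hg_apply := hg ▸ rematch_apply f u x b v b' v'
  have := hb.eq_of_apply_eq u hu
  have := hb'.eq_of_apply_eq x hx
  have := hb.not_isCritical_of_apply_eq hm hu
  have := hb.not_isCritical_of_apply_eq hm hv.apply_eq
  have := hb'.not_isCritical_of_apply_eq hm hv'.apply_eq
  have := hv.apply_eq
  have := hv'.apply_eq
  refine ⟨⟨?_, ?_⟩, ⟨?_, ?_⟩, ⟨?_, ?_⟩⟩ <;> grind [hv.ne, hv'.ne]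

theorem IsCritical.matched_ssubset_matched_rematch {b b' u x v v' : V} (hm : 2 ≤ m)
    (hb : IsCritical G m f b) (hb' : IsCritical G m f b') (hbb' : b ≠ b') (hu : f u = b)
    (hx : f x = b') (hv : IsPartner f b u v) (hv' : IsPartner f b' x v') :
    matched f ⊂ matched (rematch f u x b v b' v') := by
  obtain ⟨⟨hgu, hgx⟩, ⟨hgb, hgv⟩, hgb', hgv'⟩ :=
    hb.rematch_apply_of_isPartner hm hb' hbb' hu hx hv hv' rfl
  have hg_of_ne {t : V} (htu : t ≠ u) (htx : t ≠ x) (htb : t ≠ b) (htb' : t ≠ b') :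
      rematch f u x b v b' v' t = f t := by simp [rematch_apply, htu, htx, htb, htb']
  set g := rematch f u x b v b' v'
  refine (Set.ssubset_iff_of_subset fun t (ht : f (f t) = t) => ?_).2 ?_
  · change g (g t) = t
    by_cases htu : t = u; · rw [htu, hgu, hgx]
    by_cases htx : t = x; · rw [htx, hgx, hgu]
    by_cases htb : f t = b
    · obtain rfl : v = t := (hv.eq_apply (by grind)).trans (by rw [← htb, ht])
      rw [hgv, hgb]
    by_cases htb' : f t = b'
    · obtain rfl : v' = t := (hv'.eq_apply (by grind)).trans (by rw [← htb', ht])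
      rw [hgv', hgb']
    by_cases htb₀ : t = b; · rw [htb₀, hgb, hgv]
    by_cases htb₀' : t = b'; · rw [htb₀', hgb', hgv']
    rw [hg_of_ne htu htx htb₀ htb₀', hg_of_ne (fun h => htb₀ (hb.eq_of_apply_eq u hu t h))
      (fun h => htb₀' (hb'.eq_of_apply_eq x hx t h)) htb htb', ht]
  · by_cases hfu : f (f u) = u
    · exact ⟨v, by simp only [matched, Set.mem_ofPred_eq, hgv, hgb],
        fun hfv : f (f v) = v => hv.ne (by rw [← hfv, hv.apply_eq, ← hu, hfu])⟩
    · exact ⟨u, by simp only [matched, Set.mem_ofPred_eq, hgu, hgx], hfu⟩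

theorem IsCritical.not_adj_of_maximalFor (hm : 2 ≤ m)
    (hf : MaximalFor (IsAssignment G m) matched f) {b b' u x : V} (hb : IsCritical G m f b)
    (hb' : IsCritical G m f b') (hu : f u = b) (hx : f x = b') : ¬ G.Adj u x := fun hux => by
  have hcube := apply_apply_apply_of_maximalFor hm hf
  have hbb' : b ≠ b' := by
    rintro rfl
    exact hb.not_adj u hu x hx hux
  obtain ⟨v, hv⟩ := hb.exists_isPartner hm hcube u
  obtain ⟨v', hv'⟩ := hb'.exists_isPartner hm hcube x
  exact hf.not_gt (hb.isAssignment_rematch hm hb' hbb' hu hx hv hv' hf.prop hux)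
    (hb.matched_ssubset_matched_rematch hm hb' hbb' hu hx hv hv')

end Assignment

theorem exists_level_of_forall_reflTransGen {α : Type*} {R : α → α → Prop} {B : Set α}
    (h : ∀ c, ∃ b ∈ B, Relation.ReflTransGen R c b) :
    ∃ lev : α → ℕ, ∀ c ∉ B, ∃ x, R c x ∧ lev x < lev c := by
  let IsChain (c : α) (n : ℕ) : Prop :=
    ∃ p : ℕ → α, p 0 = c ∧ p n ∈ B ∧ ∀ i < n, R (p i) (p (i + 1))
  have exists_isChain (c : α) : ∃ n, IsChain c n := by
    obtain ⟨b, hb, hcb⟩ := h c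
    induction hcb using Relation.ReflTransGen.head_induction_on with
    | refl => exact ⟨0, fun _ => b, rfl, hb, by simp⟩
    | head hac _ ih =>
      obtain ⟨n, p, rfl, hpn, hp⟩ := ih
      refine ⟨n + 1, fun | 0 => _ | i + 1 => p i, rfl, hpn, fun i hi => ?_⟩
      cases i with
      | zero => exact hac
      | succ i => exact hp i (by lia)
  refine ⟨fun c => sInf {n | IsChain c n}, fun c hc => ?_⟩
  obtain ⟨p, hp0, hpB, hp⟩ : IsChain c (sInf {n | IsChain c n}) := Nat.sInf_mem (exists_isChain c)
  cases hn : sInf {n | IsChain c n} with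
  | zero => exact absurd (by rwa [hn, hp0] at hpB) hc
  | succ n =>
    rw [hn] at hpB hp
    have : IsChain (p 1) n := ⟨fun i => p (i + 1), rfl, hpB, fun i hi => hp (i + 1) (by lia)⟩
    refine ⟨p 1, hp0 ▸ hp 0 n.succ_pos, (Nat.sInf_le this).trans_lt ?_⟩
    exact n.lt_succ_self.trans_eq hn.symm

theorem IsAssignment.exists_level {V : Type*} [Fintype V] [DecidableEq V] {G : SimpleGraph V}
    {m : ℕ} {f : V → V} (hf : IsAssignment G m f) (hG : IsolatedBound G m) (hm : 2 ≤ m) :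
    ∃ lev : V → ℕ, ∀ c, #{v | f v = c} = m → ∃ u x, f u = c ∧ G.Adj u x ∧ lev x < lev c := by
  classical
  let R (c x : V) : Prop := ∃ u, f u = c ∧ G.Adj u x
  let B : Set V := {c | #{v | f v = c} ≠ m}
  suffices ∀ c, ∃ b ∈ B, Relation.ReflTransGen R c b by
    obtain ⟨lev, hlev⟩ := exists_level_of_forall_reflTransGen this
    refine ⟨lev, fun c hc => ?_⟩
    obtain ⟨x, ⟨u, hu, hux⟩, hx⟩ := hlev c (by simpa [B] using hc)
    exact ⟨u, x, hu, hux, hx⟩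
  by_contra! hstuck
  let C : Finset V := {c | ∀ b ∈ B, ¬ Relation.ReflTransGen R c b}
  have mem_C {c : V} : c ∈ C ↔ ∀ b ∈ B, ¬ Relation.ReflTransGen R c b := by simp [C]
  have full : ∀ c ∈ C, m ≤ #{v | f v = c} := fun c hc => by
    by_contra h
    exact mem_C.1 hc c (fun h' => h h'.ge) .refl
  have neighbors_subset : ({w | ∃ x ∈ ({v | f v ∈ C} : Finset V), G.Adj x w} : Finset V) ⊆ C :=
    fun w hw => by
      obtain ⟨x, hx, hxw⟩ : ∃ x, f x ∈ C ∧ G.Adj x w := by simpa using hw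
      exact mem_C.2 fun b hb hwb => mem_C.1 hx b hb (.head ⟨x, rfl, hxw⟩ hwb)
  obtain ⟨c, hc⟩ := hstuck
  have card_le := mul_card_le_card_preimage full
  have nonempty : ({v | f v ∈ C} : Finset V).Nonempty :=
    card_pos.1 <| (Nat.mul_pos (by lia) (card_pos.2 ⟨c, mem_C.2 hc⟩)).trans_le card_le
  have card_lt := hG.card_lt_mul_card_neighbors hm (fun v => ⟨f v, hf.adj v⟩) nonempty
  exact (card_le.trans_lt card_lt).not_ge (Nat.mul_le_mul_left m (card_le_card neighbors_subset))

/-! ### Spanning forests -/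

/-- The graph joining every vertex `v` to `g v`. -/
def functionGraph {V : Type*} (g : V → V) : SimpleGraph V :=
  SimpleGraph.fromRel fun u v => v = g u

theorem functionGraph_le {V : Type*} {G : SimpleGraph V} {g : V → V} (h : ∀ v, G.Adj v (g v)) :
    functionGraph g ≤ G := by
  rintro u v ⟨-, rfl | rfl⟩
  exacts [h u, (h v).symm]

theorem functionGraph_adj_apply {V : Type*} {g : V → V} {v : V} (h : v ≠ g v) :
    (functionGraph g).Adj v (g v) := ⟨h, .inl rfl⟩

theorem isAcyclic_functionGraph {V : Type*} {g : V → V} (rank : V → ℕ)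
    (h : ∀ v, rank (g v) < rank v ∨ rank (g v) ≤ rank v ∧ g (g v) = v) :
    (functionGraph g).IsAcyclic := by
  classical
  intro a w hw
  obtain ⟨v, hv, hmax⟩ := w.support.toFinset.exists_max_image rank ⟨a, by simp⟩
  rw [List.mem_toFinset] at hv
  have hc := hw.rotate hv
  set c := w.rotate v hv
  have eq_apply (y : V) (hvy : (functionGraph g).Adj v y) (hy : y ∈ c.support) : y = g v := by
    obtain ⟨-, rfl | rfl⟩ := hvy
    · rfl
    · have := hmax y (List.mem_toFinset.2 ((SimpleGraph.Walk.mem_support_rotate_iff w _ hv).1 hy))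
      rcases h y with hlt | ⟨-, hgg⟩
      · exact absurd hlt this.not_gt
      · exact hgg.symm
  exact hc.snd_ne_penultimate <|
    (eq_apply c.snd (c.adj_snd hc.not_nil) (c.getVert_mem_support 1)).trans
      (eq_apply c.penultimate (c.adj_penultimate hc.not_nil).symm (c.getVert_mem_support _)).symm

section Forest

variable {V : Type*} [Fintype V] [DecidableEq V] {G : SimpleGraph V} {m : ℕ} {f : V → V}

open Classical in
/-- The map `f` changed so that every critical vertex `b` is joined to the rest of the graph through
its chosen neighbour `esc b`, which is sent to `out b`. -/
noncomputable def redirect (G : SimpleGraph V) (m : ℕ) (f esc out : V → V) (v : V) : V :=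
  if IsCritical G m f v then esc v
  else if IsCritical G m f (f v) ∧ v = esc (f v) then out (f v) else f v

open Classical in
/-- A rank that does not increase along `redirect G m f esc out`, provided `out b` has a lower level
than `b`. The levels are tripled to make room for the vertices choosing `b` on both sides of `b`. -/
noncomputable def redirectRank (G : SimpleGraph V) (m : ℕ) (f esc : V → V) (lev : V → ℕ) (v : V) :
    ℕ :=
  if IsCritical G m f v then 3 * lev v + 1
  else if IsCritical G m f (f v) then
    if v = esc (f v) then 3 * lev (f v) else 3 * lev (f v) + 2
  else if f (f v) = v then 1 else 2

variable {esc out : V → V}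

theorem functionGraph_redirect_adj (hm : 2 ≤ m) (hf : MaximalFor (IsAssignment G m) matched f)
    (hadj : ∀ v, G.Adj v (redirect G m f esc out v)) (v : V) :
    (functionGraph (redirect G m f esc out)).Adj v (f v) := by
  have hcube := apply_apply_apply_of_maximalFor hm hf
  have adj_apply {v : V} (hv : redirect G m f esc out v = f v) :
      (functionGraph (redirect G m f esc out)).Adj v (f v) :=
    hv ▸ functionGraph_adj_apply (hadj v).ne
  have adj_esc {b : V} (hb : IsCritical G m f b) :
      (functionGraph (redirect G m f esc out)).Adj b (esc b) := by
    have : redirect G m f esc out b = esc b := if_pos hb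
    exact this ▸ functionGraph_adj_apply (hadj b).ne
  by_cases hv : IsCritical G m f v
  · by_cases hfv : f v = esc v
    · exact hfv ▸ adj_esc hv
    · have hffv := hv.apply_apply hm hcube
      have hv' := hv.not_isCritical_of_apply_eq hm hffv
      have : redirect G m f esc out (f v) = f (f v) := by simp [redirect, hv', hffv, hfv]
      exact (hffv ▸ adj_apply this).symm
  · by_cases hfv : IsCritical G m f (f v) ∧ v = esc (f v)
    · have := (adj_esc hfv.1).symm
      rwa [← hfv.2] at this
    · exact adj_apply (by simp [redirect, hv, hfv])

theorem redirect_esc (hm : 2 ≤ m) (hesc : ∀ b, IsCritical G m f b → f (esc b) = b) {b : V}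
    (hb : IsCritical G m f b) :
    redirect G m f esc out (esc b) = out b := by
  have := hb.not_isCritical_of_apply_eq hm (hesc b hb)
  simp [redirect, this, hesc b hb, hb]

theorem isAcyclic_functionGraph_redirect (hm : 2 ≤ m)
    (hesc : ∀ b, IsCritical G m f b → f (esc b) = b)
    (hf : MaximalFor (IsAssignment G m) matched f) {lev : V → ℕ}
    (hadj : ∀ b, IsCritical G m f b → G.Adj (esc b) (out b))
    (hlev : ∀ b, IsCritical G m f b → lev (out b) < lev b) :
    (functionGraph (redirect G m f esc out)).IsAcyclic := by
  have hcube := apply_apply_apply_of_maximalFor hm hf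
  refine isAcyclic_functionGraph (redirectRank G m f esc lev) fun v => ?_
  by_cases hv : IsCritical G m f v
  · left
    have := hv.not_isCritical_of_apply_eq hm (hesc v hv)
    simp [redirect, redirectRank, hv, this, hesc v hv]
  by_cases hfv : IsCritical G m f (f v)
  · left
    by_cases hv_esc : v = esc (f v)
    · set b := f v
      have hout : ¬ IsCritical G m f (f (out b)) := fun h =>
        hfv.not_adj_of_maximalFor hm hf h (hesc b hfv) rfl (hadj b hfv)
      have := hlev b hfv
      rw [hv_esc, redirect_esc hm hesc hfv]
      grind [redirectRank]
    · simp [redirect, redirectRank, hv, hfv, hv_esc]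
  · have hffv : ¬ IsCritical G m f (f (f v)) := fun h =>
      hv (h.eq_of_apply_eq (f v) rfl v rfl ▸ h)
    have hredirect : redirect G m f esc out v = f v := by simp [redirect, hv, hfv]
    have hredirect' : redirect G m f esc out (f v) = f (f v) := by simp [redirect, hfv, hffv]
    have hrank : redirectRank G m f esc lev (f v) = 1 := by simp [redirectRank, hfv, hffv, hcube]
    rw [hredirect, hredirect', hrank]
    by_cases h : f (f v) = v <;> simp [redirectRank, hv, hfv, h]

theorem IsolatedBound.exists_forest (hG : IsolatedBound G m) (hm : 2 ≤ m)
    (hf : MaximalFor (IsAssignment G m) matched f) :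
    ∃ F ≤ G, F.IsAcyclic ∧ (∀ v, F.Adj v (f v)) ∧
      ∀ b, IsCritical G m f b → ∃ u x, f u = b ∧ x ≠ b ∧ F.Adj u x := by
  obtain ⟨lev, hlev⟩ := hf.prop.exists_level hG hm
  choose! esc out hesc hadj hlt using fun b (hb : IsCritical G m f b) => hlev b hb.card_fiber
  have adj_redirect (v : V) : G.Adj v (redirect G m f esc out v) := by
    unfold redirect
    split_ifs with hv hfv
    · have := (hf.prop.adj (esc v)).symm
      rwa [hesc v hv] at this
    · have := hadj _ hfv.1
      rwa [← hfv.2] at this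
    · exact hf.prop.adj v
  refine ⟨functionGraph (redirect G m f esc out), functionGraph_le adj_redirect,
    isAcyclic_functionGraph_redirect hm hesc hf hadj hlt,
    functionGraph_redirect_adj hm hf adj_redirect, fun b hb =>
      ⟨esc b, out b, hesc b hb, ?_, ?_⟩⟩
  · exact fun h => (h ▸ hlt b hb).false
  · have := functionGraph_adj_apply (adj_redirect (esc b)).ne
    rwa [redirect_esc hm hesc hb] at this

end Forest

theorem forall_of_connected_of_adj {V : Type*} {G : SimpleGraph V} (hG : G.Connected)
    {P : V → Prop} {a : V} (ha : P a) (hP : ∀ u v, P u → G.Adj u v → P v) (b : V) : P b := by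
  obtain ⟨w⟩ := hG.preconnected a b
  induction w with
  | nil => exact ha
  | cons h _ ih => exact ih (hP _ _ ha h)

theorem IsLeaf.eq_of_adj {V : Type*} {T : SimpleGraph V} {w a b : V} (hw : IsLeaf T w)
    (ha : T.Adj w a) (hb : T.Adj w b) : a = b :=
  Set.encard_le_one_iff.1 (Set.encard_eq_one.2 (Set.ncard_eq_one.1 hw)).le a b ha hb

/-! ### Moving leaves -/

/-- A cherry of `T`: two leaves `u` and `w` with a common neighbour `c`. -/
structure IsCherry {V : Type*} (T : SimpleGraph V) (c u w : V) : Prop where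
  adj_left : T.Adj c u
  isLeaf_left : IsLeaf T u
  adj_right : T.Adj c w
  isLeaf_right : IsLeaf T w
  ne : u ≠ w

/-- The graph `T` has leaf degrees at most `k + 1`, and each vertex where the bound is attained is
the centre of a cherry whose leaves are adjacent in `G`, so that one of them can be hung on the
other. -/
def IsRepairable {V : Type*} (G : SimpleGraph V) (k : ℕ) (T : SimpleGraph V) : Prop :=
  ∀ v, vertexLeafDegree T v ≤ k + 1 ∧
    (vertexLeafDegree T v = k + 1 → ∃ u w, IsCherry T v u w ∧ G.Adj u w)

theorem IsolatedBound.exists_isRepairable {V : Type*} [Finite V] {G : SimpleGraph V} {k : ℕ}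
    (hG : IsolatedBound G (k + 1)) (hk : 1 ≤ k) (hconn : G.Connected) (hnbr : ∀ v, ∃ w, G.Adj v w) :
    ∃ T, IsSpanningTree T G ∧ IsRepairable G k T := by
  classical
  cases nonempty_fintype V
  have hm : 2 ≤ k + 1 := by lia
  obtain ⟨f, hf⟩ := Set.Finite.exists_maximalFor matched {f | IsAssignment G (k + 1) f}
    (Set.toFinite _) (hG.exists_isAssignment hm hnbr)
  obtain ⟨F, hFG, hF, hadj, hcritical⟩ := hG.exists_forest hm hf
  obtain ⟨T, hFT, hTG, hT⟩ := hconn.exists_isTree_le_of_le_of_isAcyclic hFG hF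
  refine ⟨T, ⟨hTG, hT⟩, fun v => ?_⟩
  have leaves_subset : {w | T.Adj v w ∧ IsLeaf T w} ⊆ (({w | f w = v} : Finset V) : Set V) := by
    rintro w ⟨hvw, hw⟩
    simpa using hw.eq_of_adj (hFT (hadj w)) hvw.symm
  have card_le := (Set.ncard_le_ncard leaves_subset).trans_eq (Set.ncard_coe_finset _)
  refine ⟨card_le.trans (hf.prop.card_fiber_le v), fun hv => ?_⟩
  have card_fiber : #{w | f w = v} = k + 1 :=
    (hf.prop.card_fiber_le v).antisymm (hv.symm.trans_le card_le)
  have leaf (u : V) (hu : f u = v) : T.Adj v u ∧ IsLeaf T u := by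
    have := Set.eq_of_subset_of_ncard_le leaves_subset
      (by rw [Set.ncard_coe_finset, card_fiber]; exact hv.ge)
    exact this.ge (by simpa using hu)
  by_contra! hnot_adj
  obtain ⟨u, x, hu, hx, hux⟩ := hcritical v
    { card_fiber := card_fiber
      eq_of_apply_eq := fun u hu t ht =>
        (leaf u hu).2.eq_of_adj (ht ▸ (hFT (hadj t)).symm) (leaf u hu).1.symm
      not_adj := fun u hu x hx =>
        fun hux => hnot_adj u x ⟨(leaf u hu).1, (leaf u hu).2, (leaf x hx).1, (leaf x hx).2, hux.ne⟩
          hux }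
  exact hx ((leaf u hu).2.eq_of_adj (hFT hux) (leaf u hu).1.symm)

/-- The graph obtained from `T` by detaching the vertex `w` and hanging it as a leaf on `u`. -/
def hang {V : Type*} (T : SimpleGraph V) (u w : V) : SimpleGraph V :=
  T.deleteIncidenceSet w ⊔ SimpleGraph.edge u w

theorem hang_adj_iff {V : Type*} {T : SimpleGraph V} {u w a b : V} (huw : u ≠ w) :
    (hang T u w).Adj a b ↔
      T.Adj a b ∧ a ≠ w ∧ b ≠ w ∨ (u = a ∧ w = b ∨ u = b ∧ w = a) := by
  rw [hang, SimpleGraph.sup_adj, SimpleGraph.deleteIncidenceSet_adj, SimpleGraph.edge_adj]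
  grind

namespace IsCherry

variable {V : Type*} {G T : SimpleGraph V} {c u w : V}

theorem isTree_hang (h : IsCherry T c u w) (hT : T.IsTree) : (hang T u w).IsTree := by
  have huw : (hang T u w).Reachable u w := ((hang_adj_iff h.ne).2 (by simp)).reachable
  have hcu : (hang T u w).Reachable c u :=
    ((hang_adj_iff h.ne).2 (.inl ⟨h.adj_left, h.adj_right.ne, h.ne⟩)).reachable
  have reachable_of_adj {a b : V} (hab : T.Adj a b) : (hang T u w).Reachable a b := by
    by_cases ha : a = w
    · subst ha
      exact h.isLeaf_right.eq_of_adj h.adj_right.symm hab ▸ (hcu.trans huw).symm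
    by_cases hb : b = w
    · subst hb
      exact h.isLeaf_right.eq_of_adj h.adj_right.symm hab.symm ▸ hcu.trans huw
    · exact ((hang_adj_iff h.ne).2 (.inl ⟨hab, ha, hb⟩)).reachable
  have := hT.connected.nonempty
  refine ⟨⟨fun a b => ?_⟩, ?_⟩
  · exact forall_of_connected_of_adj hT.connected (P := (hang T u w).Reachable a) .rfl
      (fun _ _ hx hxy => hx.trans (reachable_of_adj hxy)) b
  · refine (hT.isAcyclic.anti (T.deleteIncidenceSet_le w)).sup_edge_of_not_reachable
      (SimpleGraph.not_reachable_of_neighborSet_right_eq_empty h.ne ?_)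
    ext
    simp [SimpleGraph.deleteIncidenceSet_adj]

theorem hang_le (h : IsCherry T c u w) (hTG : T ≤ G) (huw : G.Adj u w) : hang T u w ≤ G := by
  intro a b hab
  obtain hab | ⟨rfl, rfl⟩ | ⟨rfl, rfl⟩ := (hang_adj_iff h.ne).1 hab
  · exact hTG hab.1
  · exact huw
  · exact huw.symm

theorem not_isLeaf_hang_left (h : IsCherry T c u w) : ¬ IsLeaf (hang T u w) u := fun hu =>
  h.adj_right.ne <| hu.eq_of_adj
    ((hang_adj_iff h.ne).2 (.inl ⟨h.adj_left.symm, h.ne, h.adj_right.ne⟩))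
    ((hang_adj_iff h.ne).2 (.inr (.inl ⟨rfl, rfl⟩)))

theorem not_isLeaf_hang_center [Fintype V] (h : IsCherry T c u w) (hT : T.Connected)
    (hV : 4 ≤ Fintype.card V) : ¬ IsLeaf (hang T u w) c := by
  classical
  intro hc
  have adj_center {b : V} (hb : T.Adj c b) : b = u ∨ b = w := by
    by_contra! hne
    exact hne.1 <| hc.eq_of_adj
      ((hang_adj_iff h.ne).2 (.inl ⟨hb, h.adj_right.ne, hne.2⟩))
      ((hang_adj_iff h.ne).2 (.inl ⟨h.adj_left, h.adj_right.ne, h.ne⟩))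
  have mem_cherry : ∀ b, b ∈ ({c, u, w} : Finset V) := by
    refine forall_of_connected_of_adj (a := c) hT (by simp) fun a b ha hab => ?_
    simp only [mem_insert, mem_singleton] at ha ⊢
    obtain rfl | rfl | rfl := ha
    · exact .inr (adj_center hab)
    · exact .inl (h.isLeaf_left.eq_of_adj hab h.adj_left.symm)
    · exact .inl (h.isLeaf_right.eq_of_adj hab h.adj_right.symm)
  have := card_le_card (subset_iff.2 fun b (_ : b ∈ univ) => mem_cherry b)
  have := card_le_three (a := c) (b := u) (c := w)
  rw [card_univ] at *
  lia

theorem isLeaf_of_isLeaf_hang [Fintype V] (h : IsCherry T c u w) (hT : T.Connected)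
    (hV : 4 ≤ Fintype.card V) {z : V} (hz : IsLeaf (hang T u w) z) : IsLeaf T z := by
  by_cases hzw : z = w
  · exact hzw ▸ h.isLeaf_right
  have hzu : z ≠ u := by rintro rfl; exact h.not_isLeaf_hang_left hz
  have hzc : z ≠ c := by rintro rfl; exact h.not_isLeaf_hang_center hT hV hz
  have neighborSet_eq : T.neighborSet z = (hang T u w).neighborSet z := by
    ext b
    have : T.Adj z b → b ≠ w := by
      rintro hzb rfl
      exact hzc (h.isLeaf_right.eq_of_adj hzb.symm h.adj_right.symm)
    simp only [SimpleGraph.mem_neighborSet, hang_adj_iff h.ne]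
    grind
  rwa [IsLeaf, neighborSet_eq]

theorem leaves_hang_subset [Fintype V] (h : IsCherry T c u w) (hT : T.Connected)
    (hV : 4 ≤ Fintype.card V) {v : V} (hv : v ≠ u) :
    {z | (hang T u w).Adj v z ∧ IsLeaf (hang T u w) z} ⊆ {z | T.Adj v z ∧ IsLeaf T z} := by
  rintro z ⟨hvz, hz⟩
  refine ⟨?_, h.isLeaf_of_isLeaf_hang hT hV hz⟩
  obtain hvz | ⟨rfl, -⟩ | ⟨rfl, -⟩ := (hang_adj_iff h.ne).1 hvz
  · exact hvz.1
  · exact absurd rfl hv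
  · exact absurd hz h.not_isLeaf_hang_left

theorem vertexLeafDegree_hang_left_le [Fintype V] (h : IsCherry T c u w) (hT : T.Connected)
    (hV : 4 ≤ Fintype.card V) : vertexLeafDegree (hang T u w) u ≤ 1 := by
  refine (Set.ncard_le_ncard ?_).trans_eq (Set.ncard_singleton w)
  rintro z ⟨huz, hz⟩
  obtain huz | ⟨-, rfl⟩ | ⟨-, hwu⟩ := (hang_adj_iff h.ne).1 huz
  · rw [h.isLeaf_left.eq_of_adj huz.1 h.adj_left.symm] at hz
    exact absurd hz (h.not_isLeaf_hang_center hT hV)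
  · rfl
  · exact absurd hwu.symm h.ne

theorem isRepairable_hang [Fintype V] (h : IsCherry T c u w) (hT : T.Connected)
    (hV : 4 ≤ Fintype.card V) {k : ℕ} (hk : 1 ≤ k) (hrep : IsRepairable G k T) :
    IsRepairable G k (hang T u w) := by
  intro v
  by_cases hv : v = u
  · have := h.vertexLeafDegree_hang_left_le hT hV
    exact ⟨by rw [hv]; lia, fun hvk => by rw [hv] at hvk; lia⟩
  have leaves_subset := h.leaves_hang_subset hT hV hv
  have degree_le : vertexLeafDegree (hang T u w) v ≤ vertexLeafDegree T v :=
    Set.ncard_le_ncard leaves_subset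
  obtain ⟨hvk, hcherry⟩ := hrep v
  refine ⟨degree_le.trans hvk, fun heq => ?_⟩
  obtain ⟨a, b, hab, hG⟩ := hcherry (hvk.antisymm (heq ▸ degree_le))
  have leaves_eq := Set.eq_of_subset_of_ncard_le leaves_subset (hvk.trans_eq heq.symm)
  obtain ⟨hva, ha⟩ := leaves_eq.ge ⟨hab.adj_left, hab.isLeaf_left⟩
  obtain ⟨hvb, hb⟩ := leaves_eq.ge ⟨hab.adj_right, hab.isLeaf_right⟩
  exact ⟨a, b, ⟨hva, ha, hvb, hb, hab.ne⟩, hG⟩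

theorem leaves_hang_ssubset [Fintype V] (h : IsCherry T c u w) (hT : T.Connected)
    (hV : 4 ≤ Fintype.card V) : {z | IsLeaf (hang T u w) z} ⊂ {z | IsLeaf T z} :=
  Set.ssubset_iff_of_subset (fun _ hz => h.isLeaf_of_isLeaf_hang hT hV hz) |>.2
    ⟨u, h.isLeaf_left, h.not_isLeaf_hang_left⟩

end IsCherry

theorem IsolatedBound.exists_isSpanningTree {V : Type*} [Fintype V] {G : SimpleGraph V} {k : ℕ}
    (hG : IsolatedBound G (k + 1)) (hk : 1 ≤ k) (hconn : G.Connected) (hV : 4 ≤ Fintype.card V) :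
    ∃ T, IsSpanningTree T G ∧ leafDegree T ≤ k := by
  have : Nontrivial V := Fintype.one_lt_card_iff_nontrivial.1 (by lia)
  obtain ⟨T, ⟨hTG, hrep⟩, hmin⟩ := exists_minimalFor_of_wellFoundedLT
    (fun T => IsSpanningTree T G ∧ IsRepairable G k T) (fun T => {z | IsLeaf T z}.ncard)
    (hG.exists_isRepairable hk hconn hconn.preconnected.exists_adj_of_nontrivial)
  refine ⟨T, hTG, Finset.sup_le fun v _ => ?_⟩
  by_contra! hv
  obtain ⟨u, w, hcherry, huw⟩ := (hrep v).2 ((hrep v).1.antisymm hv)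
  have hT := hTG.2.connected
  have := hmin ⟨⟨hcherry.hang_le hTG.1 huw, hcherry.isTree_hang hTG.2⟩,
    hcherry.isRepairable_hang hT hV hk hrep⟩
    (Set.ncard_le_ncard (hcherry.leaves_hang_ssubset hT hV).subset)
  exact this.not_gt (Set.ncard_lt_ncard (hcherry.leaves_hang_ssubset hT hV))

/-! ### Kaneko's criterion -/

theorem eq_of_adj_of_dist {V : Type*} {T : SimpleGraph V} (hT : T.IsTree)
    {r v a b : V} (ha : T.Adj a v) (hb : T.Adj b v) (hda : T.dist r v = T.dist r a + 1)
    (hdb : T.dist r v = T.dist r b + 1) : a = b := by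
  obtain ⟨p, hp⟩ := hT.connected.exists_walk_length_eq_dist r a
  obtain ⟨q, hq⟩ := hT.connected.exists_walk_length_eq_dist r b
  have hpa : (p.concat ha).IsPath :=
    SimpleGraph.Walk.isPath_of_length_eq_dist _ (by simp [hp, hda])
  have hqb : (q.concat hb).IsPath :=
    SimpleGraph.Walk.isPath_of_length_eq_dist _ (by simp [hq, hdb])
  simpa using congrArg SimpleGraph.Walk.penultimate
    ((hT.existsUnique_path r v).unique hpa hqb)

theorem exists_adj_dist_eq_add_one {V : Type*} {T : SimpleGraph V} (hT : T.IsTree) {r v : V}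
    (hvr : v ≠ r) (hv : ¬ IsLeaf T v) : ∃ w, T.Adj v w ∧ T.dist r w = T.dist r v + 1 := by
  have : Nontrivial V := ⟨v, r, hvr⟩
  obtain ⟨a, ha⟩ := hT.connected.preconnected.exists_adj_of_nontrivial v
  obtain ⟨b, hb, hba⟩ : ∃ b, T.Adj v b ∧ b ≠ a := by
    by_contra! hall
    exact hv (Set.ncard_eq_one.2 ⟨a, Set.Subset.antisymm hall (Set.singleton_subset_iff.2 ha)⟩)
  by_contra! hnone
  exact hba <| eq_of_adj_of_dist hT hb.symm ha.symm
    ((hT.dist_eq_dist_add_one_of_adj r hb).resolve_right (hnone b hb))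
    ((hT.dist_eq_dist_add_one_of_adj r ha).resolve_right (hnone a ha))

theorem card_le_leafDegree_mul {V : Type*} [Fintype V] {T : SimpleGraph V} {S L : Finset V}
    (hL : ∀ v ∈ L, IsLeaf T v ∧ ∃ w ∈ S, T.Adj v w) : #L ≤ leafDegree T * #S := by
  classical
  have subset_biUnion : L ⊆ S.biUnion fun s => {w | T.Adj s w ∧ IsLeaf T w} := by
    intro v hv
    obtain ⟨hleaf, w, hw, hvw⟩ := hL v hv
    exact mem_biUnion.2 ⟨w, hw, by simpa using ⟨hvw.symm, hleaf⟩⟩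
  rw [mul_comm]
  refine (card_le_card subset_biUnion).trans (card_biUnion_le_card_mul _ _ _ fun s _ => ?_)
  refine le_trans (le_of_eq ?_) (le_sup (f := vertexLeafDegree T) (mem_univ s))
  rw [vertexLeafDegree, ← Set.ncard_coe_finset, coe_filter_univ]

-- Root the tree in `S`: every other nonleaf vertex outside `S` has a child, which lies in `S`.
theorem card_lt_of_forall_adj_mem {V : Type*} {T : SimpleGraph V} (hT : T.IsTree) {S N : Finset V}
    (hS : S.Nonempty) (hN : ∀ v ∈ N, v ∉ S ∧ ¬ IsLeaf T v ∧ ∀ w, T.Adj v w → w ∈ S) :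
    #N < #S := by
  classical
  obtain ⟨r, hr⟩ := hS
  choose! child adj_child dist_child using fun v hv => exists_adj_dist_eq_add_one hT
    (ne_of_mem_of_not_mem hr (hN v hv).1).symm (hN v hv).2.1
  refine (card_le_card_of_injOn child (fun v hv => ?_) fun v hv v' hv' hvv' => ?_).trans_lt
    (card_erase_lt_of_mem hr)
  · refine mem_erase.2 ⟨fun heq => ?_, (hN v hv).2.2 _ (adj_child v hv)⟩
    have := dist_child v hv
    rw [heq, SimpleGraph.dist_self] at this
    lia
  · exact eq_of_adj_of_dist hT (adj_child v hv) (hvv' ▸ adj_child v' hv') (dist_child v hv)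
      (hvv' ▸ dist_child v' hv')

theorem IsSpanningTree.isolatedBound {V : Type*} [Fintype V] {T G : SimpleGraph V}
    (hT : IsSpanningTree T G) : IsolatedBound G (leafDegree T + 1) := by
  classical
  rintro S I hS hI
  have leaves_le : #{v ∈ I | IsLeaf T v} ≤ leafDegree T * #S := by
    refine card_le_leafDegree_mul fun v hv => ?_
    obtain ⟨hvI, hleaf⟩ := mem_filter.1 hv
    obtain ⟨w, hw⟩ := Set.ncard_eq_one.1 hleaf
    have hvw : T.Adj v w := hw.ge rfl
    exact ⟨hleaf, w, (hI v hvI).2 w (hT.1 hvw), hvw⟩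
  have nonleaves_lt : #{v ∈ I | ¬ IsLeaf T v} < #S :=
    card_lt_of_forall_adj_mem hT.2 hS fun v hv =>
      have ⟨hvI, hleaf⟩ := mem_filter.1 hv
      ⟨(hI v hvI).1, hleaf, fun w hw => (hI v hvI).2 w (hT.1 hw)⟩
  rw [← card_filter_add_card_filter_not (fun v => IsLeaf T v), add_one_mul]
  lia

theorem IsolatedBound.mono_right {V : Type*} {G : SimpleGraph V} {m n : ℕ} (hG : IsolatedBound G m)
    (hmn : m ≤ n) : IsolatedBound G n :=
  fun S I hS hI => (hG S I hS hI).trans_le (Nat.mul_le_mul_right _ hmn)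

theorem exists_isSpanningTree_leafDegree_le_iff {V : Type*} [Fintype V] {G : SimpleGraph V} {k : ℕ}
    (hk : 1 ≤ k) (hconn : G.Connected) (hV : 4 ≤ Fintype.card V) :
    (∃ T, IsSpanningTree T G ∧ leafDegree T ≤ k) ↔ IsolatedBound G (k + 1) :=
  ⟨fun ⟨_, hT, hTk⟩ => hT.isolatedBound.mono_right (Nat.succ_le_succ hTk),
    fun hG => hG.exists_isSpanningTree hk hconn hV⟩

/-! ### Split graphs -/

/-- The largest graph in which all neighbours of vertices of `I` lie in `S`. For disjoint `S` and
`I` it is a copy of `K_a ∨ (K_b + I_c)` with `a = #S`, `b = #(S ∪ I)ᶜ` and `c = #I`. -/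
def splitGraph {V : Type*} (S I : Finset V) : SimpleGraph V where
  Adj u v := u ≠ v ∧ (u ∈ I → v ∈ S) ∧ (v ∈ I → u ∈ S)
  symm := ⟨fun _ _ h => ⟨h.1.symm, h.2.symm⟩⟩
  loopless := ⟨fun _ h => h.1 rfl⟩

theorem splitGraph_adj_iff {V : Type*} {S I : Finset V} {u v : V} :
    (splitGraph S I).Adj u v ↔ u ≠ v ∧ (u ∈ I → v ∈ S) ∧ (v ∈ I → u ∈ S) :=
  Iff.rfl

theorem le_splitGraph_iff {V : Type*} {G : SimpleGraph V} {S I : Finset V} :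
    G ≤ splitGraph S I ↔ ∀ v ∈ I, ∀ w, G.Adj v w → w ∈ S :=
  ⟨fun h _ hv _ hvw => (h hvw).2.1 hv,
    fun h u v huv => ⟨huv.ne, fun hu => h u hu v huv, fun hv => h v hv u huv.symm⟩⟩

theorem not_isolatedBound_iff {V : Type*} {G : SimpleGraph V} {m : ℕ} :
    ¬ IsolatedBound G m ↔
      ∃ S I : Finset V, S.Nonempty ∧ Disjoint S I ∧ #I = m * #S ∧ G ≤ splitGraph S I := by
  simp only [IsolatedBound, le_splitGraph_iff]
  push Not
  constructor
  · rintro ⟨S, I₀, hS, hI₀, hcard⟩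
    obtain ⟨I, hI, hI_card⟩ := exists_subset_card_eq hcard
    exact ⟨S, I, hS, disjoint_right.2 fun v hv => (hI₀ v (hI hv)).1, hI_card,
      fun v hv => (hI₀ v (hI hv)).2⟩
  · rintro ⟨S, I, hS, hSI, hcard, hI⟩
    exact ⟨S, I, hS, fun v hv => ⟨disjoint_right.1 hSI hv, hI v hv⟩, hcard.ge⟩

theorem IsolatedBound.of_iso {V W : Type*} {G : SimpleGraph V} {H : SimpleGraph W} {m : ℕ}
    (hG : IsolatedBound G m) (e : G ≃g H) : IsolatedBound H m := by
  intro S I hS hI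
  have mem_map_symm {A : Finset W} {v : V} : v ∈ A.map e.symm.toEquiv.toEmbedding ↔ e v ∈ A :=
    mem_map_equiv
  have := hG (S.map e.symm.toEquiv.toEmbedding) (I.map e.symm.toEquiv.toEmbedding) hS.map
    fun v hv => by
      simp only [mem_map_symm] at hv ⊢
      exact ⟨(hI _ hv).1, fun w hvw => (hI _ hv).2 _ (e.map_adj_iff.2 hvw)⟩
  simpa only [card_map] using this

theorem joinCompleteUnion_eq_splitGraph (a b c : ℕ) :
    joinCompleteUnion a b c =
      splitGraph (univ.disjSum ∅) (disjSum ∅ (disjSum ∅ univ)) := by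
  ext (u | u | u) (v | v | v) <;> simp [joinCompleteUnion, join, splitGraph_adj_iff]

theorem not_isolatedBound_joinCompleteUnion {a b c m : ℕ} (ha : 0 < a) (hc : c = m * a) :
    ¬ IsolatedBound (joinCompleteUnion a b c) m :=
  not_isolatedBound_iff.2 ⟨_, _, by simpa [Finset.Nonempty] using ⟨⟨0, ha⟩⟩,
    by simp [disjoint_left], by simpa using hc,
    (joinCompleteUnion_eq_splitGraph a b c).le⟩

theorem card_membership_fiber {V : Type*} [Fintype V] [DecidableEq V] {S I : Finset V}
    (hSI : Disjoint S I) (c : Bool × Bool) :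
    Fintype.card {v // (decide (v ∈ S), decide (v ∈ I)) = c} =
      match c with
      | (true, true) => 0
      | (true, false) => #S
      | (false, true) => #I
      | (false, false) => Fintype.card V - (#S + #I) := by
  rw [Fintype.card_subtype, ← card_union_of_disjoint hSI, ← card_compl, ← card_empty (α := V)]
  rw [disjoint_left] at hSI
  obtain ⟨_ | _, _ | _⟩ := c <;> dsimp only <;> congr 1 <;> ext v <;> simp <;> grind

theorem nonempty_iso_splitGraph {V W : Type*} [Fintype V] [Fintype W] {S I : Finset V}
    {S' I' : Finset W} (hSI : Disjoint S I) (hSI' : Disjoint S' I') (hS : #S = #S')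
    (hI : #I = #I') (hVW : Fintype.card V = Fintype.card W) :
    Nonempty (splitGraph S I ≃g splitGraph S' I') := by
  classical
  have card_fiber (c : Bool × Bool) :
      Fintype.card {v // (decide (v ∈ S), decide (v ∈ I)) = c} =
        Fintype.card {v // (decide (v ∈ S'), decide (v ∈ I')) = c} := by
    rw [card_membership_fiber hSI, card_membership_fiber hSI', hS, hI, hVW]
  let e : V ≃ W := Equiv.ofFiberEquiv fun c => Fintype.equivOfCardEq (card_fiber c)
  have mem_iff (v : V) : (e v ∈ S' ↔ v ∈ S) ∧ (e v ∈ I' ↔ v ∈ I) := by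
    have := Equiv.ofFiberEquiv_map (fun c => Fintype.equivOfCardEq (card_fiber c)) v
    simpa only [Prod.mk.injEq, decide_eq_decide] using this
  exact ⟨e, by simp [splitGraph_adj_iff, mem_iff]⟩

open Matrix

/-! ### Comparison of spectral radii -/

theorem mem_adjEigenvalues_iff {V : Type*} [Fintype V] {G : SimpleGraph V} [DecidableRel G.Adj]
    {μ : ℝ} : μ ∈ adjEigenvalues G ↔ ∃ x ≠ 0, G.adjMatrix ℝ *ᵥ x = μ • x := by
  classical
  have : μ ∈ adjEigenvalues G ↔ Module.End.HasEigenvalue (Matrix.toLin' (G.adjMatrix ℝ)) μ := by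
    unfold adjEigenvalues
    convert Iff.rfl
  rw [this]
  refine ⟨fun h => ?_, fun ⟨x, hx, h⟩ => ?_⟩
  · obtain ⟨x, hx⟩ := h.exists_hasEigenvector
    exact ⟨x, hx.2, by simpa using hx.apply_eq_smul⟩
  · exact Module.End.hasEigenvalue_of_hasEigenvector (x := x)
      ⟨Module.End.mem_eigenspace_iff.2 (by simpa using h), hx⟩

section Perron

variable {V : Type*} [Fintype V] {G : SimpleGraph V} [DecidableRel G.Adj] {x y : V → ℝ} {r μ : ℝ}

theorem smul_abs_le_adjMatrix_mulVec_abs (hx : G.adjMatrix ℝ *ᵥ x = μ • x) (hr : r ≤ μ) :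
    r • |x| ≤ G.adjMatrix ℝ *ᵥ |x| := by
  intro v
  calc r * |x v| ≤ |μ| * |x v| := by gcongr; exact hr.trans (le_abs_self μ)
    _ = |∑ w ∈ G.neighborFinset v, x w| := by
      rw [← SimpleGraph.adjMatrix_mulVec_apply, hx, Pi.smul_apply, smul_eq_mul, abs_mul]
    _ ≤ ∑ w ∈ G.neighborFinset v, |x w| := abs_sum_le_sum_abs _ _
    _ = (G.adjMatrix ℝ *ᵥ |x|) v := (SimpleGraph.adjMatrix_mulVec_apply ..).symm

-- Symmetry of the adjacency matrix gives `r (y ⬝ x) ≤ A y ⬝ x = y ⬝ A x ≤ r (y ⬝ x)`.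
theorem adjMatrix_mulVec_eq_of_le_of_le (hx : ∀ v, 0 < x v) (hy : 0 ≤ y)
    (hle_x : G.adjMatrix ℝ *ᵥ x ≤ r • x) (hle_y : r • y ≤ G.adjMatrix ℝ *ᵥ y) :
    G.adjMatrix ℝ *ᵥ y = r • y ∧ ∀ v, 0 < y v → (G.adjMatrix ℝ *ᵥ x) v = r * x v := by
  have symm : (G.adjMatrix ℝ *ᵥ y) ⬝ᵥ x = y ⬝ᵥ (G.adjMatrix ℝ *ᵥ x) := by
    rw [dotProduct_mulVec, ← mulVec_transpose, SimpleGraph.transpose_adjMatrix]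
  have upper (v : V) : y v * (G.adjMatrix ℝ *ᵥ x) v ≤ y v * (r • x) v :=
    mul_le_mul_of_nonneg_left (hle_x v) (hy v)
  have lower (v : V) : (r • y) v * x v ≤ (G.adjMatrix ℝ *ᵥ y) v * x v :=
    mul_le_mul_of_nonneg_right (hle_y v) (hx v).le
  have smul_comm : (r • y) ⬝ᵥ x = y ⬝ᵥ (r • x) := by rw [smul_dotProduct, dotProduct_smul]
  have sum_upper : y ⬝ᵥ (G.adjMatrix ℝ *ᵥ x) ≤ y ⬝ᵥ (r • x) := sum_le_sum fun v _ => upper v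
  have sum_lower : (r • y) ⬝ᵥ x ≤ (G.adjMatrix ℝ *ᵥ y) ⬝ᵥ x := sum_le_sum fun v _ => lower v
  have upper_eq := (sum_eq_sum_iff_of_le fun v _ => upper v).1
    (sum_upper.antisymm (by rwa [← smul_comm, ← symm]))
  have lower_eq := (sum_eq_sum_iff_of_le fun v _ => lower v).1
    (sum_lower.antisymm (by rwa [symm, smul_comm]))
  exact ⟨funext fun v => (mul_right_cancel₀ (hx v).ne' (lower_eq v (mem_univ v))).symm,
    fun v hv => mul_left_cancel₀ hv.ne' (upper_eq v (mem_univ v))⟩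

theorem pos_of_adjMatrix_mulVec_eq (hG : G.Connected) (hy : 0 ≤ y) (hy0 : y ≠ 0)
    (heq : G.adjMatrix ℝ *ᵥ y = r • y) (v : V) : 0 < y v := by
  obtain ⟨a, ha⟩ := Function.ne_iff.1 hy0
  refine forall_of_connected_of_adj hG (P := fun v => 0 < y v) ((hy a).lt_of_ne' ha) ?_ v
  refine fun u w hu huw => (hy w).lt_of_ne' fun hw => hu.ne' ?_
  have sum_eq_zero : ∑ z ∈ G.neighborFinset w, y z = 0 := by
    rw [← SimpleGraph.adjMatrix_mulVec_apply, heq, Pi.smul_apply, hw, Pi.zero_apply, smul_zero]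
  exact (sum_eq_zero_iff_of_nonneg fun z _ => hy z).1 sum_eq_zero u
    ((G.mem_neighborFinset w u).2 huw.symm)

theorem adjMatrix_mulVec_eq_of_le (hG : G.Connected) (hx : ∀ v, 0 < x v)
    (hle : G.adjMatrix ℝ *ᵥ x ≤ r • x) (hμ : μ ∈ adjEigenvalues G) (hr : r ≤ μ) :
    G.adjMatrix ℝ *ᵥ x = r • x := by
  obtain ⟨u, hu0, hu⟩ := mem_adjEigenvalues_iff.1 hμ
  obtain ⟨habs, hx_eq⟩ := adjMatrix_mulVec_eq_of_le_of_le hx (abs_nonneg u) hle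
    (smul_abs_le_adjMatrix_mulVec_abs hu hr)
  exact funext fun v => hx_eq v
    (pos_of_adjMatrix_mulVec_eq hG (abs_nonneg u) (by simpa using hu0) habs v)

variable {H : SimpleGraph V} [DecidableRel H.Adj]

theorem neighborFinset_subset_of_le (hGH : G ≤ H) (v : V) :
    G.neighborFinset v ⊆ H.neighborFinset v := fun w hw => by
  rw [SimpleGraph.mem_neighborFinset] at hw ⊢
  exact hGH hw

theorem adjMatrix_mulVec_mono (hGH : G ≤ H) (hx : 0 ≤ x) :
    G.adjMatrix ℝ *ᵥ x ≤ H.adjMatrix ℝ *ᵥ x := fun v => by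
  simp only [SimpleGraph.adjMatrix_mulVec_apply]
  exact sum_le_sum_of_subset_of_nonneg (neighborFinset_subset_of_le hGH v)
    fun w _ _ => hx w

theorem eq_of_adjMatrix_mulVec_eq (hGH : G ≤ H) (hx : ∀ v, 0 < x v)
    (heq : G.adjMatrix ℝ *ᵥ x = H.adjMatrix ℝ *ᵥ x) : G = H := by
  refine hGH.antisymm fun v w hvw => ?_
  by_contra hG
  refine (sum_lt_sum_of_subset (f := x) (i := w) ?_ ?_ ?_ (hx w) fun u _ _ => (hx u).le).ne
    (by simpa only [SimpleGraph.adjMatrix_mulVec_apply] using congrFun heq v)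
  · exact neighborFinset_subset_of_le hGH v
  · simpa using hvw
  · simpa using hG

end Perron

theorem eq_of_le_of_adjMatrix_mulVec_le {V : Type*} [Fintype V] {G H : SimpleGraph V}
    [DecidableRel H.Adj] {x : V → ℝ} {r : ℝ} (hG : G.Connected) (hGH : G ≤ H) (hx : ∀ v, 0 < x v)
    (hle : H.adjMatrix ℝ *ᵥ x ≤ r • x) (hr : r ≤ spectralRadius G) :
    G = H ∧ H.adjMatrix ℝ *ᵥ x = r • x := by
  classical
  have := hG.nonempty
  have mulVec_mono := adjMatrix_mulVec_mono hGH fun v => (hx v).le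
  have mulVec_eq := adjMatrix_mulVec_eq_of_le hG hx (mulVec_mono.trans hle)
    (spectralRadius_isGreatest G).1 hr
  have := mulVec_mono.antisymm (hle.trans_eq mulVec_eq.symm)
  exact ⟨eq_of_adjMatrix_mulVec_eq hGH hx this, this ▸ mulVec_eq⟩

/-! ### The quotient polynomial -/

/-- The characteristic polynomial `det (x - Q)` of the quotient matrix
`Q = !![a - 1, b, c; a, b - 1, 0; a, 0, 0]` of `K_a ∨ (K_b + I_c)`. -/
def quotientPoly (a b c x : ℝ) : ℝ :=
  (x ^ 2 - (a - 1) * x - c * a) * (x - b + 1) - a * b * x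

section SplitVector

variable {V : Type*} [Fintype V] [DecidableEq V] {S I : Finset V} {r : ℝ}

/-- The vector that is constant on the three parts of `splitGraph S I`, equal to `1` on `S`, and
satisfies the eigenvalue equation for `r` at the vertices outside `S`. -/
noncomputable def splitVector (S I : Finset V) (r : ℝ) (v : V) : ℝ :=
  if v ∈ S then 1 else if v ∈ I then #S / r else #S / (r - #(S ∪ I)ᶜ + 1)

theorem splitVector_pos (hS : S.Nonempty) (hr : 0 < r) (hbr : (#(S ∪ I)ᶜ : ℝ) - 1 < r) (v : V) :
    0 < splitVector S I r v := by
  have : (0 : ℝ) < #S := by exact_mod_cast hS.card_pos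
  have : 0 < r - #(S ∪ I)ᶜ + 1 := by linarith
  unfold splitVector
  split_ifs <;> positivity

theorem sum_splitVector_left : ∑ v ∈ S, splitVector S I r v = #S := by
  rw [sum_congr rfl fun v hv => show splitVector S I r v = 1 from if_pos hv]
  simp

theorem sum_splitVector_right (hSI : Disjoint S I) :
    ∑ v ∈ I, splitVector S I r v = #I * (#S / r) := by
  rw [sum_congr rfl fun v hv => show splitVector S I r v = #S / r by
    rw [splitVector, if_neg (disjoint_right.1 hSI hv), if_pos hv]]
  simp

theorem sum_splitVector_compl :
    ∑ v ∈ (S ∪ I)ᶜ, splitVector S I r v = #(S ∪ I)ᶜ * (#S / (r - #(S ∪ I)ᶜ + 1)) := by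
  rw [sum_congr rfl fun v hv => show splitVector S I r v = #S / (r - #(S ∪ I)ᶜ + 1) by
    rw [mem_compl, mem_union, not_or] at hv
    rw [splitVector, if_neg hv.1, if_neg hv.2]]
  simp

theorem adjMatrix_mulVec_splitVector_of_mem [DecidableRel (splitGraph S I).Adj]
    (hSI : Disjoint S I) (hr : 0 < r) (hbr : (#(S ∪ I)ᶜ : ℝ) - 1 < r) {v : V} (hv : v ∈ S) :
    r - ((splitGraph S I).adjMatrix ℝ *ᵥ splitVector S I r) v =
      quotientPoly #S #(S ∪ I)ᶜ #I r / (r * (r - #(S ∪ I)ᶜ + 1)) := by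
  have neighbors : (splitGraph S I).neighborFinset v = univ.erase v := by
    ext w
    have := disjoint_left.1 hSI hv
    rw [SimpleGraph.mem_neighborFinset, splitGraph_adj_iff]
    simp [hv, this, eq_comm]
  have sum_univ : ∑ w, splitVector S I r w =
      #S + #I * (#S / r) + #(S ∪ I)ᶜ * (#S / (r - #(S ∪ I)ᶜ + 1)) := by
    rw [← sum_add_sum_compl (S ∪ I), sum_union hSI, sum_splitVector_left,
      sum_splitVector_right hSI, sum_splitVector_compl]
  rw [SimpleGraph.adjMatrix_mulVec_apply, neighbors, sum_erase_eq_sub (mem_univ v), sum_univ,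
    splitVector, if_pos hv, quotientPoly]
  have : r - #(S ∪ I)ᶜ + 1 ≠ 0 := by linarith
  field_simp
  ring

theorem adjMatrix_mulVec_splitVector_of_notMem [DecidableRel (splitGraph S I).Adj]
    (hSI : Disjoint S I) (hr : 0 < r) (hbr : (#(S ∪ I)ᶜ : ℝ) - 1 < r) {v : V} (hv : v ∉ S) :
    ((splitGraph S I).adjMatrix ℝ *ᵥ splitVector S I r) v = r * splitVector S I r v := by
  have notMem_right : ∀ w ∈ S, w ∉ I := fun _ hw => disjoint_left.1 hSI hw
  rw [SimpleGraph.adjMatrix_mulVec_apply]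
  by_cases hvI : v ∈ I
  · have neighbors : (splitGraph S I).neighborFinset v = S := by
      ext w
      rw [SimpleGraph.mem_neighborFinset, splitGraph_adj_iff]
      grind
    rw [neighbors, sum_splitVector_left, splitVector, if_neg hv, if_pos hvI,
      mul_div_cancel₀ _ hr.ne']
  · have neighbors : (splitGraph S I).neighborFinset v = (S ∪ (S ∪ I)ᶜ).erase v := by
      ext w
      rw [SimpleGraph.mem_neighborFinset, splitGraph_adj_iff]
      grind [mem_compl]
    have hvb : v ∈ S ∪ (S ∪ I)ᶜ := by simp [hv, hvI]
    have : r - #(S ∪ I)ᶜ + 1 ≠ 0 := by linarith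
    rw [neighbors, sum_erase_eq_sub hvb,
      sum_union (disjoint_compl_right.mono_left subset_union_left),
      sum_splitVector_left, sum_splitVector_compl, splitVector, if_neg hv, if_neg hvI]
    field_simp
    ring

theorem mem_adjEigenvalues_splitGraph (hS : S.Nonempty) (hSI : Disjoint S I) (hr : 0 < r)
    (hbr : (#(S ∪ I)ᶜ : ℝ) - 1 < r) (hroot : quotientPoly #S #(S ∪ I)ᶜ #I r = 0) :
    r ∈ adjEigenvalues (splitGraph S I) := by
  classical
  refine mem_adjEigenvalues_iff.2 ⟨splitVector S I r, fun h => ?_, funext fun v => ?_⟩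
  · have ⟨v, _⟩ := hS
    exact (splitVector_pos hS hr hbr v).ne' (congrFun h v)
  · by_cases hv : v ∈ S
    · have := adjMatrix_mulVec_splitVector_of_mem hSI hr hbr hv
      rw [hroot, zero_div, sub_eq_zero] at this
      simp [← this, splitVector, hv]
    · exact adjMatrix_mulVec_splitVector_of_notMem hSI hr hbr hv

theorem eq_splitGraph_of_le_spectralRadius {G : SimpleGraph V} (hG : G.Connected)
    (hS : S.Nonempty) (hSI : Disjoint S I) (hGS : G ≤ splitGraph S I) (hr : 0 < r)
    (hbr : (#(S ∪ I)ᶜ : ℝ) - 1 < r) (hpoly : 0 ≤ quotientPoly #S #(S ∪ I)ᶜ #I r)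
    (hrG : r ≤ spectralRadius G) :
    quotientPoly #S #(S ∪ I)ᶜ #I r = 0 ∧ G = splitGraph S I := by
  classical
  have hd : 0 < r - #(S ∪ I)ᶜ + 1 := by linarith
  have defect {v : V} (hv : v ∈ S) := adjMatrix_mulVec_splitVector_of_mem hSI hr hbr hv
  have hle : (splitGraph S I).adjMatrix ℝ *ᵥ splitVector S I r ≤ r • splitVector S I r := by
    intro v
    by_cases hv : v ∈ S
    · have : 0 ≤ quotientPoly #S #(S ∪ I)ᶜ #I r / (r * (r - #(S ∪ I)ᶜ + 1)) := by positivity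
      rw [← defect hv, sub_nonneg] at this
      simpa [splitVector, hv] using this
    · exact (adjMatrix_mulVec_splitVector_of_notMem hSI hr hbr hv).le
  obtain ⟨hG_eq, heq⟩ :=
    eq_of_le_of_adjMatrix_mulVec_le hG hGS (splitVector_pos hS hr hbr) hle hrG
  refine ⟨?_, hG_eq⟩
  obtain ⟨v, hv⟩ := hS
  have := defect hv
  rw [heq] at this
  have hzero : quotientPoly #S #(S ∪ I)ᶜ #I r / (r * (r - #(S ∪ I)ᶜ + 1)) = 0 := by
    rw [← this]
    simp [splitVector, hv]
  exact (div_eq_zero_iff.1 hzero).resolve_right (by positivity)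

end SplitVector

section QuotientPoly

variable {m n d s r : ℝ}

theorem quotientPoly_lt_zero (hm : 2 ≤ m) (hd : 1 ≤ d) :
    quotientPoly d (n - (m + 1) * d) (m * d) (n - m * d - 1) < 0 := by
  have : quotientPoly d (n - (m + 1) * d) (m * d) (n - m * d - 1) = -(m * d ^ 3) := by
    unfold quotientPoly
    ring
  rw [this, neg_lt_zero]
  positivity

theorem quotientPoly_self_nonneg (hm : 2 ≤ m) (hd : 1 ≤ d) (hn : 3 * (m + 1) * d + 2 ≤ n) :
    0 ≤ quotientPoly d (n - (m + 1) * d) (m * d) n := by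
  have hmd : 2 * d ≤ m * d := by gcongr
  have quadratic_ge : n ^ 2 / 2 ≤ n ^ 2 - (d - 1) * n - m * d * d := by
    have : m * d * d ≤ n * d := by gcongr; linarith
    have : 9 * d * n ≤ n * n := by gcongr <;> linarith
    nlinarith
  have main_ge : n ^ 2 / 2 * (3 * d) ≤
      (n ^ 2 - (d - 1) * n - m * d * d) * (n - (n - (m + 1) * d) + 1) := by
    refine mul_le_mul quadratic_ge ?_ (by positivity) (le_trans (by positivity) quadratic_ge)
    linarith
  have tail_le : d * (n - (m + 1) * d) * n ≤ d * n * n := by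
    gcongr <;> linarith
  have : 0 ≤ d * n ^ 2 := by positivity
  unfold quotientPoly
  linarith

theorem exists_quotientPoly_root (hm : 2 ≤ m) (hd : 1 ≤ d) (hn : 3 * (m + 1) * d + 2 ≤ n) :
    ∃ r, n - m * d - 1 < r ∧ quotientPoly d (n - (m + 1) * d) (m * d) r = 0 := by
  have continuous : Continuous (quotientPoly d (n - (m + 1) * d) (m * d)) := by
    unfold quotientPoly
    fun_prop
  have : 0 ≤ m * d := by positivity
  have neg := quotientPoly_lt_zero (n := n) hm hd
  obtain ⟨r, hr, hr0⟩ := intermediate_value_Icc (by linarith : n - m * d - 1 ≤ n)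
    continuous.continuousOn ⟨neg.le, quotientPoly_self_nonneg hm hd hn⟩
  refine ⟨r, hr.1.lt_of_ne ?_, hr0⟩
  rintro rfl
  exact neg.ne hr0

theorem quotientPoly_eq_add :
    quotientPoly s (n - (m + 1) * s) (m * s) r = quotientPoly d (n - (m + 1) * d) (m * d) r +
      m * (s - d) *
        (r ^ 2 - (s + d - 1) * r + (s + d) * (n - 1) - (m + 1) * (s ^ 2 + s * d + d ^ 2)) := by
  unfold quotientPoly
  ring

theorem quotientPoly_pos (hm : 2 ≤ m) (hd : 1 ≤ d) (hn : 3 * (m + 1) * d + 2 ≤ n) (hds : d < s)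
    (hsn : (m + 1) * s ≤ n) (hr : n - m * d - 1 < r)
    (hroot : quotientPoly d (n - (m + 1) * d) (m * d) r = 0) :
    0 < quotientPoly s (n - (m + 1) * s) (m * s) r := by
  rw [quotientPoly_eq_add, hroot, zero_add]
  refine mul_pos (mul_pos (by linarith) (by linarith)) ?_
  have : 3 * s ≤ n := by nlinarith
  have : 9 * d ≤ n - 2 := by nlinarith
  have : 2 * n / 3 * ((n - 1) / 3) ≤ (r + 1) * (r - s - d) := by
    apply mul_le_mul <;> linarith
  have : (m + 1) * d * d ≤ (n - 2) / 3 * ((n - 2) / 9) := by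
    apply mul_le_mul <;> linarith
  have : (m + 1) * s * (s + d) ≤ n * (s + d) := by gcongr; linarith
  nlinarith

end QuotientPoly

theorem le_spectralRadius_joinCompleteUnion {a b c : ℕ} {r : ℝ} (ha : 0 < a) (hr : 0 < r)
    (hbr : (b : ℝ) - 1 < r) (hroot : quotientPoly a b c r = 0) :
    r ≤ spectralRadius (joinCompleteUnion a b c) := by
  have : NeZero a := ⟨ha.ne'⟩
  have hcompl : #((univ.disjSum ∅ : Finset (Fin a ⊕ (Fin b ⊕ Fin c))) ∪
      disjSum ∅ (disjSum ∅ univ))ᶜ = b := by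
    rw [card_compl, card_union_of_disjoint]
    · simp; omega
    · simp [disjoint_left]
  refine (spectralRadius_isGreatest _).2 ?_
  rw [joinCompleteUnion_eq_splitGraph]
  refine mem_adjEigenvalues_splitGraph ?_ ?_ hr ?_ ?_
  · exact ⟨Sum.inl 0, by simp⟩
  · simp [disjoint_left]
  · rwa [hcompl]
  · rw [hcompl]
    simpa using hroot

theorem nonempty_iso_joinCompleteUnion {V : Type*} [Fintype V] {S I : Finset V} {a b c : ℕ}
    (hSI : Disjoint S I) (hS : #S = a) (hI : #I = c) (hV : Fintype.card V = a + (b + c)) :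
    Nonempty (splitGraph S I ≃g joinCompleteUnion a b c) := by
  rw [joinCompleteUnion_eq_splitGraph]
  refine nonempty_iso_splitGraph hSI ?_ ?_ ?_ ?_
  · simp [disjoint_left]
  · simpa using hS
  · simpa using hI
  · simpa using hV

theorem card_eq_and_eq_splitGraph {V : Type*} [Fintype V] {G : SimpleGraph V} {S I : Finset V}
    {m d b : ℕ} (hm : 2 ≤ m) (hd : 1 ≤ d) (hV : Fintype.card V = b + (m + 1) * d)
    (hn : 3 * (m + 1) * d + 2 ≤ Fintype.card V) (hG : G.Connected) (hSI : Disjoint S I)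
    (hI : #I = m * #S) (hdS : d ≤ #S) (hGS : G ≤ splitGraph S I)
    (hρ : spectralRadius (joinCompleteUnion d b (m * d)) ≤ spectralRadius G) :
    #S = d ∧ G = splitGraph S I := by
  classical
  have hcard : #(S ∪ I)ᶜ + (m + 1) * #S = Fintype.card V := by
    rw [← card_compl_add_card (S ∪ I), card_union_of_disjoint hSI, hI]
    ring
  have hSn : ((m : ℝ) + 1) * #S ≤ Fintype.card V := by
    exact_mod_cast Nat.le.intro (add_comm _ _ |>.trans hcard)
  have hb : (b : ℝ) = Fintype.card V - (m + 1) * d := by rw [hV]; push_cast; ring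
  have hb' : (#(S ∪ I)ᶜ : ℝ) = Fintype.card V - (m + 1) * #S := by rw [← hcard]; push_cast; ring
  rify at hm hd hdS hn hI
  obtain ⟨r, hr, hroot⟩ := exists_quotientPoly_root hm hd hn
  have hpos : (d : ℝ) < #S → 0 < quotientPoly #S #(S ∪ I)ᶜ #I r := by
    rw [hI, hb']
    exact fun hlt => quotientPoly_pos hm hd hn hlt hSn hr hroot
  have hr0 : 0 < r := by nlinarith
  have hrG : r ≤ spectralRadius G := by
    refine (le_spectralRadius_joinCompleteUnion (by exact_mod_cast hd) hr0 ?_ ?_).trans hρ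
    · rw [hb]
      linarith
    · rwa [hb, Nat.cast_mul]
  have hnonneg : 0 ≤ quotientPoly #S #(S ∪ I)ᶜ #I r := by
    obtain hlt | heq := hdS.lt_or_eq
    · exact (hpos hlt).le
    · rw [hI, hb', ← heq, hroot]
  obtain ⟨hzero, hGS_eq⟩ := eq_splitGraph_of_le_spectralRadius hG
    (card_pos.1 (by exact_mod_cast zero_lt_one.trans_le (hd.trans hdS))) hSI hGS hr0
    (by nlinarith) hnonneg hrG
  refine ⟨?_, hGS_eq⟩
  by_contra hne
  exact (hpos (hdS.lt_of_ne fun h => hne (by exact_mod_cast h.symm))).ne' hzero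

theorem minDegree_le_card_of_le_splitGraph {V : Type*} [Fintype V] {G : SimpleGraph V}
    [DecidableRel G.Adj] {S I : Finset V} (hGS : G ≤ splitGraph S I) (hI : I.Nonempty) :
    G.minDegree ≤ #S := by
  obtain ⟨v, hv⟩ := hI
  refine (G.minDegree_le_degree v).trans (card_le_card fun w hw => ?_)
  exact le_splitGraph_iff.1 hGS v hv w ((G.mem_neighborFinset v w).1 hw)

end LeafDegreeSpectral

theorem theorem1p14 {V : Type*} [Fintype V] (G : SimpleGraph V) [DecidableRel G.Adj]
    (n δ k : ℕ) (hk : 1 ≤ k) (hconn : G.Connected) (hn : Fintype.card V = n)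
    (hδ : G.minDegree = δ) (hnδ : 3 * (k + 2) * δ + 2 ≤ n)
    (hρ : LeafDegreeSpectral.spectralRadius
        (LeafDegreeSpectral.joinCompleteUnion δ (n - k * δ - 2 * δ) (k * δ + δ)) ≤
      LeafDegreeSpectral.spectralRadius G) :
    (∃ T : SimpleGraph V, LeafDegreeSpectral.IsSpanningTree T G ∧
        LeafDegreeSpectral.leafDegree T ≤ k) ↔
      ¬ Nonempty
        (G ≃g LeafDegreeSpectral.joinCompleteUnion δ (n - k * δ - 2 * δ) (k * δ + δ)) := by
  subst hn hδ
  have : Nontrivial V := Fintype.one_lt_card_iff_nontrivial.1 (by lia)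
  have hδ : 0 < G.minDegree := hconn.preconnected.minDegree_pos_of_nontrivial
  obtain ⟨b, hV⟩ : ∃ b, Fintype.card V = b + (k + 1 + 1) * G.minDegree :=
    Nat.exists_eq_add_of_le' (by nlinarith)
  have hb : Fintype.card V - k * G.minDegree - 2 * G.minDegree = b := by lia
  rw [hb, ← Nat.succ_mul] at hρ ⊢
  rw [LeafDegreeSpectral.exists_isSpanningTree_leafDegree_le_iff hk hconn (by lia)]
  constructor
  · rintro hbound ⟨e⟩
    exact LeafDegreeSpectral.not_isolatedBound_joinCompleteUnion hδ rfl (hbound.of_iso e)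
  · contrapose!
    rw [LeafDegreeSpectral.not_isolatedBound_iff]
    rintro ⟨S, I, hS, hSI, hI, hGS⟩
    have hIne : I.Nonempty := Finset.card_pos.1 (hI ▸ Nat.mul_pos k.succ_pos hS.card_pos)
    obtain ⟨hSδ, hG⟩ := LeafDegreeSpectral.card_eq_and_eq_splitGraph (by lia) hδ hV hnδ hconn hSI
      hI (LeafDegreeSpectral.minDegree_le_card_of_le_splitGraph hGS hIne) hGS hρ
    have hiso := LeafDegreeSpectral.nonempty_iso_joinCompleteUnion hSI hSδ (hSδ ▸ hI)
      (by rw [hV]; ring)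
    rwa [← hG] at hiso
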